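/- Let $\|\cdot\|$ be the Frobenius norm, and for a matrix $A\in\mathbb{R}^{p\times q}$ let $\sigma_1(A)\ge\sigma_2(A)\ge\dots$ be its singular values, $\sigma_{\max}(A)=\sigma_1(A)$, $\sigma_{\min}(A)=\sigma_{\min\{p,q\}}(A)$, and $\sigma_*(A)$ the smallest nonzero singular value. Let $X_{\rm trn}\in\mathbb{R}^{N\times m}$, $X_{\rm val}\in\mathbb{R}^{N'\times m}$ have full row rank (with $m\ge\max\{N,N'\}$), let $Y_{\rm trn}\in\mathbb{R}^{N\times n}$, $Y_{\rm val}\in\mathbb{R}^{N'\times n}$, let $h\ge\max\{m,n\}$, and for $W_1\in\mathbb{R}^{m\times h}$, $W_2\in\mathbb{R}^{h\times n}$ put $$L_{\rm trn}(W_1,W_2)=\tfrac12\|Y_{\rm trn}-X_{\rm trn}W_1W_2\|^2,\quad L_{\rm val}(W_1,W_2)=\tfrac12\|Y_{\rm val}-X_{\rm val}W_1W_2\|^2,\quad L^*_{\rm trn}(W_1)=\min_{W_2}L_{\rm trn}(W_1,W_2),$$ $$L_\gamma(W_1,W_2)=L_{\rm val}(W_1,W_2)+\gamma\,(L_{\rm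 trn}(W_1,W_2)-L^*_{\rm trn}(W_1)),\qquad \gamma>0,\qquad L_\gamma^*=\min_{W_1,W_2}L_\gamma(W_1,W_2).$$ Call $(W_1^*,W_2^*)$ an $(\epsilon_1,\epsilon_2)$ solution of the bilevel problem if $L_{\rm trn}(W_1^*,W_2^*)-L^*_{\rm trn}(W_1^*)\le\epsilon_2$ and $L_{\rm val}(W_1^*,W_2^*)\le L_{\rm val}(W_1,W_2)+\epsilon_1$ for all $(W_1,W_2)$ with $L_{\rm trn}(W_1,W_2)-L^*_{\rm trn}(W_1)\le\epsilon_2$. Assume that for all $\epsilon_1,\epsilon_2\ge 0$ there is an $(\epsilon_1,\epsilon_2)$ solution $(W_1^*,W_2^*)$ with $L_{\rm trn}(W_1^*,W_2^*)-\min_{W_1,W_2}L_{\rm trn}(W_1,W_2)\le\epsilon_2$. Let $(W_1^k,W_2^k,W_3^k)_{k\ge0}$ be generated from any initial point by penalty-based bilevel gradient descent in Jacobi fashion with step sizes $\alpha>0$ and $\beta$ and inner iteration numbers $T_k$: $W_3^{k+1}$ is the result of $T_k$ steps $W\mapsto W-\beta\nabla_{W_2}L_{\rm trn}(W_1^k,W)$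 started at $W_3^0$, and $$W_1^{k+1}=W_1^k-\alpha\big(\nabla_{W_1}L_{\rm val}(W_1^k,W_2^k)+\gamma(\nabla_{W_1}L_{\rm trn}(W_1^k,W_2^k)-\nabla_{W_1}L_{\rm trn}(W_1^k,W_3^{k+1}))\big),$$ $$W_2^{k+1}=W_2^k-\alpha\big(\nabla_{W_2}L_{\rm val}(W_1^k,W_2^k)+\gamma\nabla_{W_2}L_{\rm trn}(W_1^k,W_2^k)\big).$$ Let $X_\gamma=[X_{\rm val};\sqrt\gamma X_{\rm trn}]$, and let $k$ be such that $\sigma_{\min}^2(W_1^k)>0$ and $\sigma_{\min}^2(W_2^k)>0$. Then the minimum $L_\gamma^*$ is attained, $L_\gamma$ is differentiable at $(W_1^k,W_2^k)$, $L^*_{\rm trn}$ is differentiable at $W_1^k$, and with $\mu_k=(\sigma_{\min}^2(W_1^k)+\sigma_{\min}^2(W_2^k))\,\sigma_*^2(X_\gamma)$ the joint PL inequality $$\|\nabla L_\gamma(W_1^k,W_2^k)\|^2\ge 2\mu_k\,(L_\gamma(W_1^k,W_2^k)-L_\gamma^*)$$ holds. Moreover, with $\delta_k=\gamma\,(\nabla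 L^*_{\rm trn}(W_1^k)-\nabla_{W_1}L_{\rm trn}(W_1^k,W_3^{k+1}))$, $\Delta_k=L_\gamma(W_1^k,W_2^k)-L_\gamma^*$, $s=\sigma_{\max}(X_\gamma)$ and $$\begin{aligned}L_k={}&s^2(\sigma_{\max}^2(W_1^k)+\sigma_{\max}^2(W_2^k))+3\alpha\|\delta_k\|s^2\sigma_{\max}(W_2^k)+\big(1+3\alpha s^2(\sigma_{\max}^2(W_1^k)+\sigma_{\max}^2(W_2^k))\big)\sqrt{2s^2\Delta_k}\\&+3\alpha^2s^2\|\delta_k\|\sigma_{\max}(W_1^k)\sqrt{2s^2\Delta_k}+6\alpha^2s^4\sigma_{\max}(W_1^kW_2^k)\Delta_k,\end{aligned}$$ the descent inequality holds: $$L_\gamma(W_1^{k+1},W_2^{k+1})\le L_\gamma(W_1^k,W_2^k)-\Big(\frac\alpha2-\alpha^2L_k\Big)\|\nabla L_\gamma(W_1^k,W_2^k)\|^2+\Big(\frac\alpha2+\alpha^2L_k\Big)\|\delta_k\|^2.$$ -/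

import Mathlib

open scoped Matrix

attribute [local instance] Matrix.frobeniusNormedAddCommGroup Matrix.frobeniusNormedSpace

noncomputable section

namespace BilevelRep

/-- The singular values of a real matrix in descending order, indexed from `0`
(so the `i`-th singular value in the usual numbering is `sv A (i - 1)`). -/
def sv {p q : Type*} [Fintype p] [Fintype q] [DecidableEq q] (A : Matrix p q ℝ) (i : ℕ) : ℝ :=
  (Matrix.toEuclideanLin A).singularValues i

/-- The largest singular value. -/
def sigmaMax {p q : Type*} [Fintype p] [Fintype q] [DecidableEq q] (A : Matrix p q ℝ) : ℝ :=
  sv A 0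

/-- The smallest singular value, the one with number `min p q` for a `p × q` matrix
(and `0` for a matrix without rows or without columns). -/
def sigmaMin {p q : Type*} [Fintype p] [Fintype q] [DecidableEq q] (A : Matrix p q ℝ) : ℝ :=
  if min (Fintype.card p) (Fintype.card q) = 0 then 0
  else sv A (min (Fintype.card p) (Fintype.card q) - 1)

/-- The smallest nonzero singular value (and `0` for the zero matrix). -/
def sigmaStar {p q : Type*} [Fintype p] [Fintype q] [DecidableEq q] (A : Matrix p q ℝ) : ℝ :=
  sInf {s : ℝ | 0 < s ∧ ∃ i, sv A i = s}

/-- The gradient of a real function of a matrix with respect to the Frobenius inner product: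
the matrix of its partial derivatives. -/
def matGrad {p q : Type*} [Fintype p] [Fintype q] [DecidableEq p] [DecidableEq q]
    (f : Matrix p q ℝ → ℝ) (W : Matrix p q ℝ) : Matrix p q ℝ :=
  Matrix.of fun i j => lineDeriv ℝ f W (Matrix.single i j 1)

/-- Training data (`N` samples) and validation data (`N'` samples) with features in `ℝ^m` and
labels in `ℝ^n`; samples and labels are the rows. -/
structure Data (N N' m n : ℕ) where
  Xtrn : Matrix (Fin N) (Fin m) ℝ
  Ytrn : Matrix (Fin N) (Fin n) ℝ
  Xval : Matrix (Fin N') (Fin m) ℝ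
  Yval : Matrix (Fin N') (Fin n) ℝ

namespace Data

variable {N N' m n h : ℕ} (D : Data N N' m n)

/-- Training loss of the two-layer linear network. -/
def Ltrn (W₁ : Matrix (Fin m) (Fin h) ℝ) (W₂ : Matrix (Fin h) (Fin n) ℝ) : ℝ :=
  1 / 2 * ‖D.Ytrn - D.Xtrn * W₁ * W₂‖ ^ 2

/-- Validation loss of the two-layer linear network. -/
def Lval (W₁ : Matrix (Fin m) (Fin h) ℝ) (W₂ : Matrix (Fin h) (Fin n) ℝ) : ℝ :=
  1 / 2 * ‖D.Yval - D.Xval * W₁ * W₂‖ ^ 2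

/-- The lower-level value function `min_{W₂} Ltrn(W₁, W₂)`. -/
def LtrnStar (W₁ : Matrix (Fin m) (Fin h) ℝ) : ℝ :=
  ⨅ W₂ : Matrix (Fin h) (Fin n) ℝ, D.Ltrn W₁ W₂

/-- The penalized objective. -/
def Lpen (γ : ℝ) (W₁ : Matrix (Fin m) (Fin h) ℝ) (W₂ : Matrix (Fin h) (Fin n) ℝ) : ℝ :=
  D.Lval W₁ W₂ + γ * (D.Ltrn W₁ W₂ - D.LtrnStar W₁)

/-- The optimal value of the penalized objective for hidden width `h`. -/
def LpenStar (h : ℕ) (γ : ℝ) : ℝ :=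
  ⨅ W : Matrix (Fin m) (Fin h) ℝ × Matrix (Fin h) (Fin n) ℝ, D.Lpen γ W.1 W.2

/-- The squared norm of the gradient of the penalized objective in both blocks. -/
def normSqGradLpen (γ : ℝ) (W₁ : Matrix (Fin m) (Fin h) ℝ) (W₂ : Matrix (Fin h) (Fin n) ℝ) : ℝ :=
  ‖matGrad (fun V => D.Lpen γ V W₂) W₁‖ ^ 2 + ‖matGrad (fun V => D.Lpen γ W₁ V) W₂‖ ^ 2

/-- `(W₁, W₂)` is an `(ε₁, ε₂)` global solution of the bilevel problem with upper-level
objective `Lval` and lower-level objective `Ltrn`. -/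
def IsSolution (ε₁ ε₂ : ℝ) (W₁ : Matrix (Fin m) (Fin h) ℝ) (W₂ : Matrix (Fin h) (Fin n) ℝ) :
    Prop :=
  D.Ltrn W₁ W₂ - D.LtrnStar W₁ ≤ ε₂ ∧
    ∀ (V₁ : Matrix (Fin m) (Fin h) ℝ) (V₂ : Matrix (Fin h) (Fin n) ℝ),
      D.Ltrn V₁ V₂ - D.LtrnStar V₁ ≤ ε₂ → D.Lval W₁ W₂ ≤ D.Lval V₁ V₂ + ε₁

/-- For all `ε₁, ε₂ ≥ 0` some `(ε₁, ε₂)` solution of the bilevel problem of hidden width `h` is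
`ε₂`-optimal for the training loss jointly in both layers. -/
def Compatible (h : ℕ) : Prop :=
  ∀ ε₁ ε₂ : ℝ, 0 ≤ ε₁ → 0 ≤ ε₂ →
    ∃ (W₁ : Matrix (Fin m) (Fin h) ℝ) (W₂ : Matrix (Fin h) (Fin n) ℝ),
      D.IsSolution ε₁ ε₂ W₁ W₂ ∧
        D.Ltrn W₁ W₂ -
          (⨅ V : Matrix (Fin m) (Fin h) ℝ × Matrix (Fin h) (Fin n) ℝ, D.Ltrn V.1 V.2) ≤ ε₂

/-- The concatenated data matrix `[X_val; √γ X_trn]`. -/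
def Xpen (γ : ℝ) : Matrix (Fin N' ⊕ Fin N) (Fin m) ℝ :=
  Matrix.fromRows D.Xval (√γ • D.Xtrn)

/-- One inner step: gradient descent with step size `β` on the lower-level objective. -/
def innerStep (β : ℝ) (W₁ : Matrix (Fin m) (Fin h) ℝ) (W : Matrix (Fin h) (Fin n) ℝ) :
    Matrix (Fin h) (Fin n) ℝ :=
  W - β • matGrad (fun V => D.Ltrn W₁ V) W

/-- The sequences `W₁, W₂, W₃` are generated by penalty-based bilevel gradient descent in the
Jacobi fashion, with outer step size `α`, inner step size `β` and `T k` inner steps at outer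
iteration `k`, every inner loop being initialized at `W₃ 0`. -/
def IsPBGD (γ α β : ℝ) (T : ℕ → ℕ) (W₁ : ℕ → Matrix (Fin m) (Fin h) ℝ)
    (W₂ W₃ : ℕ → Matrix (Fin h) (Fin n) ℝ) : Prop :=
  ∀ k : ℕ,
    W₃ (k + 1) = (D.innerStep β (W₁ k))^[T k] (W₃ 0) ∧
    W₁ (k + 1) = W₁ k - α • (matGrad (fun V => D.Lval V (W₂ k)) (W₁ k) +
      γ • (matGrad (fun V => D.Ltrn V (W₂ k)) (W₁ k) -
        matGrad (fun V => D.Ltrn V (W₃ (k + 1))) (W₁ k))) ∧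
    W₂ (k + 1) = W₂ k - α • (matGrad (fun V => D.Lval (W₁ k) V) (W₂ k) +
      γ • matGrad (fun V => D.Ltrn (W₁ k) V) (W₂ k))

/-- The error made in the gradient of the penalized objective at `W₁` when the gradient of the
value function is estimated by the partial gradient of the training loss at `(W₁, W₃)`. -/
def gradBias (γ : ℝ) (W₁ : Matrix (Fin m) (Fin h) ℝ) (W₃ : Matrix (Fin h) (Fin n) ℝ) :
    Matrix (Fin m) (Fin h) ℝ :=
  γ • (matGrad (fun V => D.LtrnStar V) W₁ - matGrad (fun V => D.Ltrn V W₃) W₁)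

/-- The local joint PL constant at `(W₁, W₂)`. -/
def plConst (γ : ℝ) (W₁ : Matrix (Fin m) (Fin h) ℝ) (W₂ : Matrix (Fin h) (Fin n) ℝ) : ℝ :=
  (sigmaMin W₁ ^ 2 + sigmaMin W₂ ^ 2) * sigmaStar (D.Xpen γ) ^ 2

/-- The local smoothness constant at `(W₁, W₂)` for the step size `α` and the bias `δ`. -/
def smoothConst (γ α δ : ℝ) (W₁ : Matrix (Fin m) (Fin h) ℝ)
    (W₂ : Matrix (Fin h) (Fin n) ℝ) : ℝ :=
  sigmaMax (D.Xpen γ) ^ 2 * (sigmaMax W₁ ^ 2 + sigmaMax W₂ ^ 2)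
    + 3 * α * δ * sigmaMax (D.Xpen γ) ^ 2 * sigmaMax W₂
    + (1 + 3 * α * sigmaMax (D.Xpen γ) ^ 2 * (sigmaMax W₁ ^ 2 + sigmaMax W₂ ^ 2))
      * √(2 * sigmaMax (D.Xpen γ) ^ 2 * (D.Lpen γ W₁ W₂ - D.LpenStar h γ))
    + 3 * α ^ 2 * sigmaMax (D.Xpen γ) ^ 2 * δ * sigmaMax W₁
      * √(2 * sigmaMax (D.Xpen γ) ^ 2 * (D.Lpen γ W₁ W₂ - D.LpenStar h γ))
    + 6 * α ^ 2 * sigmaMax (D.Xpen γ) ^ 4 * sigmaMax (W₁ * W₂)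
      * (D.Lpen γ W₁ W₂ - D.LpenStar h γ)

end Data

end BilevelRep

end

/-! Since `m ≤ h` and the smallest singular value of `W₁ k` is positive, `W₁ k` has a right inverse.
So does every nearby `V`, because this is an open condition. As `Xtrn` has full row rank, the
training data can then be fitted exactly from `V`, so the value function `LtrnStar` vanishes
identically near `W₁ k`. There the penalized objective is the least-squares loss of the product `W₁
* W₂` for the stacked data `Xpen`, `Ypen`, and with `G = lsGrad` at the product its partial
gradients are `G * W₂ᵀ` and `W₁ᵀ * G`.

The global minimum is that of the stacked least-squares problem. At weights with positive value
function this is not automatic, and compatibility is what gives the lower bound (`lsLoss_le_Lpen`).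
The minimum is attained because a right-invertible `W₁` makes every product reachable.

The PL inequality (`joint_pl_lsLoss`) combines the bound of `‖G‖ ^ 2` from below by the loss gap,
through the smallest nonzero singular value of `Xpen`, with the loss in norm when `G` is multiplied
by a wide `W₁ᵀ` or `W₂ᵀ`, controlled by `sigmaMin`.

For descent (`descent_lsLoss`), the loss is exactly quadratic in the product, whose increment is `-α
U + α² E`. The linear term supplies the decrease; the rest is bounded by singular values and by `‖G‖
≤ √(2 s² Δ)`. The new point may lose rank, but there `Lpen ≤ lsLoss` suffices, since the value
function is nonnegative. -/

noncomputable section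

/-! ### Operator bounds from singular values -/

namespace LinearMap

open Module

variable {E F : Type*} [NormedAddCommGroup E] [InnerProductSpace ℝ E] [FiniteDimensional ℝ E]
  [NormedAddCommGroup F] [InnerProductSpace ℝ F] [FiniteDimensional ℝ F] (T : E →ₗ[ℝ] F)

/-- An orthonormal basis of right singular vectors. -/
def rightSingularBasis : OrthonormalBasis (Fin (finrank ℝ E)) ℝ E :=
  T.isSymmetric_adjoint_comp_self.eigenvectorBasis rfl

theorem inner_rightSingularBasis_adjoint_apply (v : E) (i : Fin (finrank ℝ E)) :
    inner ℝ (T.rightSingularBasis i) (adjoint T (T v)) =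
      T.singularValues i ^ 2 * inner ℝ (T.rightSingularBasis i) v := by
  have h := T.isSymmetric_adjoint_comp_self.eigenvectorBasis_apply_self_apply rfl v i
  rw [OrthonormalBasis.repr_apply_apply, OrthonormalBasis.repr_apply_apply,
    ← T.sq_singularValues_fin rfl i] at h
  exact h

/-- The right singular basis diagonalizes `T* T`, and the left side is `⟪v, T* T v⟫`. -/
theorem norm_sq_apply_eq_sum_singularValues (v : E) :
    ‖T v‖ ^ 2 = ∑ i : Fin (finrank ℝ E), T.singularValues i ^ 2 * inner ℝ (T.rightSingularBasis i) v ^ 2 := by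
  rw [← real_inner_self_eq_norm_sq, ← adjoint_inner_right,
    ← T.rightSingularBasis.sum_inner_mul_inner]
  refine Finset.sum_congr rfl fun i _ => ?_
  rw [inner_rightSingularBasis_adjoint_apply, real_inner_comm]
  ring

theorem norm_sq_adjoint_apply_apply_eq_sum_singularValues (v : E) :
    ‖adjoint T (T v)‖ ^ 2 =
      ∑ i : Fin (finrank ℝ E), T.singularValues i ^ 4 * inner ℝ (T.rightSingularBasis i) v ^ 2 := by
  rw [← T.rightSingularBasis.sum_sq_inner_right]
  refine Finset.sum_congr rfl fun i _ => ?_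
  rw [inner_rightSingularBasis_adjoint_apply]
  ring

theorem norm_apply_le_singularValues_zero (v : E) : ‖T v‖ ≤ T.singularValues 0 * ‖v‖ := by
  have h0 := T.singularValues_nonneg 0
  refine le_of_sq_le_sq ?_ (by positivity)
  rw [norm_sq_apply_eq_sum_singularValues, mul_pow, ← T.rightSingularBasis.sum_sq_inner_right,
    Finset.mul_sum]
  gcongr with i
  · exact T.singularValues_nonneg _
  · exact T.singularValues_antitone (Nat.zero_le _)

/-- By duality: `‖T* y‖ ^ 2 = ⟪y, T T* y⟫`, to which the bound for `T` applies. -/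
theorem norm_adjoint_apply_le_singularValues_zero (y : F) :
    ‖adjoint T y‖ ≤ T.singularValues 0 * ‖y‖ := by
  rcases (norm_nonneg (adjoint T y)).eq_or_lt with h | h
  · rw [← h]
    exact mul_nonneg (T.singularValues_nonneg 0) (norm_nonneg y)
  · refine le_of_mul_le_mul_right ?_ h
    calc ‖adjoint T y‖ * ‖adjoint T y‖ = inner ℝ y (T (adjoint T y)) := by
          rw [← adjoint_inner_left, real_inner_self_eq_norm_mul_norm]
      _ ≤ ‖y‖ * ‖T (adjoint T y)‖ := real_inner_le_norm _ _
      _ ≤ ‖y‖ * (T.singularValues 0 * ‖adjoint T y‖) := by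
          gcongr
          exact T.norm_apply_le_singularValues_zero _
      _ = _ := by ring

theorem le_norm_apply_of_le_singularValues {s : ℝ} (hs : 0 ≤ s)
    (h : ∀ i < finrank ℝ E, s ≤ T.singularValues i) (v : E) : s * ‖v‖ ≤ ‖T v‖ := by
  refine le_of_sq_le_sq ?_ (norm_nonneg _)
  rw [norm_sq_apply_eq_sum_singularValues, mul_pow, ← T.rightSingularBasis.sum_sq_inner_right,
    Finset.mul_sum]
  gcongr with i
  exact h i i.isLt

/-- In the singular basis both sides are sums weighted by squares and fourth powers of singular
values. Zero singular values contribute to neither, so only the positive ones need a lower bound. -/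
theorem le_norm_adjoint_apply_apply_of_le_singularValues {s : ℝ} (hs : 0 ≤ s)
    (h : ∀ i, 0 < T.singularValues i → s ≤ T.singularValues i) (v : E) :
    s * ‖T v‖ ≤ ‖adjoint T (T v)‖ := by
  refine le_of_sq_le_sq ?_ (norm_nonneg _)
  rw [norm_sq_adjoint_apply_apply_eq_sum_singularValues, mul_pow,
    norm_sq_apply_eq_sum_singularValues, Finset.mul_sum]
  refine Finset.sum_le_sum fun i _ => ?_
  rcases (T.singularValues_nonneg i).eq_or_lt with h0 | h0
  · rw [← h0]; simp
  · have := h i h0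
    calc s ^ 2 * (T.singularValues i ^ 2 * inner ℝ (T.rightSingularBasis i) v ^ 2)
        ≤ T.singularValues i ^ 2 * (T.singularValues i ^ 2 *
          inner ℝ (T.rightSingularBasis i) v ^ 2) := by gcongr
      _ = _ := by ring

/-- If this singular value is positive, `T` has rank `finrank F`, hence is onto; then `y = T v`, and
the positive singular values are exactly those up to this index. -/
theorem singularValues_mul_norm_le_norm_adjoint (y : F) :
    T.singularValues (finrank ℝ F - 1) * ‖y‖ ≤ ‖adjoint T y‖ := by
  rcases (T.singularValues_nonneg (finrank ℝ F - 1)).eq_or_lt with h0 | h0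
  · rw [← h0, zero_mul]
    exact norm_nonneg _
  · have h1 := T.singularValues_pos_iff_lt_finrank_range.1 h0
    have h2 : T.range = ⊤ := Submodule.eq_top_of_finrank_eq (by
      have := Submodule.finrank_le T.range
      lia)
    obtain ⟨v, rfl⟩ := LinearMap.range_eq_top.1 h2 y
    refine T.le_norm_adjoint_apply_apply_of_le_singularValues h0.le (fun i hi => ?_) v
    have h3 := T.singularValues_pos_iff_lt_finrank_range.1 hi
    rw [h2, finrank_top] at h3
    exact T.singularValues_antitone (by lia)

end LinearMap

/-! ### Frobenius norm by columns -/

namespace Matrix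

variable {p q r : Type*} [Fintype p] [Fintype q] [Fintype r]

theorem frobenius_norm_sq_eq_sum (A : Matrix p q ℝ) : ‖A‖ ^ 2 = ∑ i, ∑ j, A i j ^ 2 := by
  rw [frobenius_norm_def, ← Real.rpow_natCast, ← Real.rpow_mul (by positivity)]
  norm_num

theorem frobenius_norm_sq_eq_sum_col (A : Matrix p q ℝ) :
    ‖A‖ ^ 2 = ∑ j, ‖WithLp.toLp 2 (A.col j)‖ ^ 2 := by
  rw [frobenius_norm_sq_eq_sum, Finset.sum_comm]
  simp [EuclideanSpace.norm_sq_eq]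

theorem toLp_col_mul {p q r : Type*} [Fintype q] [DecidableEq q] (A : Matrix p q ℝ) (B : Matrix q r ℝ) (j : r) :
    WithLp.toLp 2 ((A * B).col j) = toEuclideanLin A (WithLp.toLp 2 (B.col j)) := by
  ext i
  simp [mul_apply, mulVec, dotProduct]

theorem adjoint_toEuclideanLin [DecidableEq p] [DecidableEq q] (A : Matrix p q ℝ) :
    LinearMap.adjoint (toEuclideanLin A) = toEuclideanLin Aᵀ := by
  rw [← toEuclideanLin_conjTranspose_eq_adjoint, conjTranspose_eq_transpose_of_trivial]

/-- Carries operator bounds on vectors over to matrix products, column by column. -/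
theorem frobenius_norm_le_of_col {s : Type*} [Fintype s] {c d : ℝ} (hc : 0 ≤ c) (hd : 0 ≤ d)
    (A : Matrix p r ℝ) (B : Matrix s r ℝ)
    (h : ∀ j, c * ‖WithLp.toLp 2 (A.col j)‖ ≤ d * ‖WithLp.toLp 2 (B.col j)‖) :
    c * ‖A‖ ≤ d * ‖B‖ := by
  refine le_of_sq_le_sq ?_ (by positivity)
  rw [mul_pow, mul_pow, frobenius_norm_sq_eq_sum_col, frobenius_norm_sq_eq_sum_col,
    Finset.mul_sum, Finset.mul_sum]
  refine Finset.sum_le_sum fun j _ => ?_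
  rw [← mul_pow, ← mul_pow]
  exact pow_le_pow_left₀ (by positivity) (h j) 2

end Matrix

/-! ### Singular value bounds for matrix products -/

namespace BilevelRep

open Matrix Module

variable {p q r : Type*} [Fintype p] [Fintype q] [Fintype r] [DecidableEq q]

theorem sv_nonneg (A : Matrix p q ℝ) (i : ℕ) : 0 ≤ sv A i :=
  LinearMap.singularValues_nonneg _ _

theorem norm_mul_le_sigmaMax (A : Matrix p q ℝ) (B : Matrix q r ℝ) :
    ‖A * B‖ ≤ sigmaMax A * ‖B‖ := by
  have := frobenius_norm_le_of_col zero_le_one (d := sigmaMax A) (sv_nonneg A 0) (A * B) B fun j => by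
    rw [toLp_col_mul, one_mul]
    exact LinearMap.norm_apply_le_singularValues_zero _ _
  simpa using this

theorem norm_transpose_mul_le_sigmaMax [DecidableEq p] (A : Matrix p q ℝ) (B : Matrix p r ℝ) :
    ‖Aᵀ * B‖ ≤ sigmaMax A * ‖B‖ := by
  have := frobenius_norm_le_of_col zero_le_one (d := sigmaMax A) (sv_nonneg A 0) (Aᵀ * B) B fun j => by
    rw [toLp_col_mul, one_mul, ← adjoint_toEuclideanLin]
    exact LinearMap.norm_adjoint_apply_le_singularValues_zero _ _
  simpa using this

theorem norm_mul_transpose_le_sigmaMax (A : Matrix p q ℝ) (B : Matrix r q ℝ) :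
    ‖B * Aᵀ‖ ≤ sigmaMax A * ‖B‖ := by
  rw [← frobenius_norm_transpose (B * Aᵀ), ← frobenius_norm_transpose B, transpose_mul,
    transpose_transpose]
  exact norm_mul_le_sigmaMax A Bᵀ

theorem norm_mul_le_mul_sigmaMax [DecidableEq p] (A : Matrix p q ℝ) (B : Matrix r p ℝ) :
    ‖B * A‖ ≤ sigmaMax A * ‖B‖ := by
  rw [← frobenius_norm_transpose (B * A), ← frobenius_norm_transpose B, transpose_mul]
  exact norm_transpose_mul_le_sigmaMax A Bᵀ

theorem sigmaMin_nonneg (A : Matrix p q ℝ) : 0 ≤ sigmaMin A := by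
  unfold sigmaMin
  split_ifs
  exacts [le_rfl, sv_nonneg _ _]

theorem sigmaMin_mul_norm_le_norm_mul (A : Matrix p q ℝ)
    (hpq : Fintype.card q ≤ Fintype.card p) (B : Matrix q r ℝ) :
    sigmaMin A * ‖B‖ ≤ ‖A * B‖ := by
  have := frobenius_norm_le_of_col (sigmaMin_nonneg A) zero_le_one B (A * B) fun j => by
    rw [toLp_col_mul, one_mul]
    refine LinearMap.le_norm_apply_of_le_singularValues _ (sigmaMin_nonneg A) (fun i hi => ?_) _
    rw [finrank_euclideanSpace] at hi
    -- The existence of an index `i` below the number of columns excludes the default value `0` of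
    -- `sigmaMin`.
    rw [sigmaMin, min_eq_right hpq, if_neg (by lia)]
    exact LinearMap.singularValues_antitone _ (by lia)
  simpa using this

theorem sigmaMin_mul_norm_le_norm_transpose_mul [DecidableEq p] (A : Matrix p q ℝ)
    (hpq : Fintype.card p ≤ Fintype.card q) (B : Matrix p r ℝ) :
    sigmaMin A * ‖B‖ ≤ ‖Aᵀ * B‖ := by
  have := frobenius_norm_le_of_col (sigmaMin_nonneg A) zero_le_one B (Aᵀ * B) fun j => by
    rw [toLp_col_mul, one_mul, ← adjoint_toEuclideanLin, sigmaMin, min_eq_left hpq]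
    split_ifs with h0
    · rw [zero_mul]
      exact norm_nonneg _
    · have := (toEuclideanLin A).singularValues_mul_norm_le_norm_adjoint (WithLp.toLp 2 (B.col j))
      rwa [finrank_euclideanSpace] at this
  simpa using this

theorem sigmaStar_nonneg (A : Matrix p q ℝ) : 0 ≤ sigmaStar A :=
  Real.sInf_nonneg fun _ hs => hs.1.le

theorem sigmaStar_mul_norm_le [DecidableEq p] (A : Matrix p q ℝ) (B : Matrix q r ℝ) :
    sigmaStar A * ‖A * B‖ ≤ ‖Aᵀ * (A * B)‖ := by
  have := frobenius_norm_le_of_col (sigmaStar_nonneg A) zero_le_one (A * B) (Aᵀ * (A * B))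
    fun j => by
      rw [toLp_col_mul, toLp_col_mul, one_mul, ← adjoint_toEuclideanLin]
      exact LinearMap.le_norm_adjoint_apply_apply_of_le_singularValues _ (sigmaStar_nonneg A)
        (fun i hi => csInf_le ⟨0, fun _ hs => hs.1.le⟩ ⟨hi, i, rfl⟩) _
  simpa using this

end BilevelRep

/-! ### Frobenius inner product -/

namespace Matrix

section FrobeniusInner

variable {p q r : Type*} [Fintype p] [Fintype q] [Fintype r]

/-- The Frobenius inner product of real matrices. -/
def frobeniusInner (A B : Matrix p q ℝ) : ℝ := trace (Aᵀ * B)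

theorem frobeniusInner_eq_sum (A B : Matrix p q ℝ) :
    frobeniusInner A B = ∑ j, ∑ i, A i j * B i j := by
  simp [frobeniusInner, trace, mul_apply]

theorem frobeniusInner_self (A : Matrix p q ℝ) : frobeniusInner A A = ‖A‖ ^ 2 := by
  rw [frobeniusInner_eq_sum, frobenius_norm_sq_eq_sum, Finset.sum_comm]
  simp [sq]

theorem frobeniusInner_comm (A B : Matrix p q ℝ) : frobeniusInner A B = frobeniusInner B A := by
  simp [frobeniusInner_eq_sum, mul_comm]

theorem frobeniusInner_add_right (A B C : Matrix p q ℝ) :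
    frobeniusInner A (B + C) = frobeniusInner A B + frobeniusInner A C := by
  simp [frobeniusInner, Matrix.mul_add]

theorem frobeniusInner_smul_right (A B : Matrix p q ℝ) (c : ℝ) :
    frobeniusInner A (c • B) = c * frobeniusInner A B := by
  simp [frobeniusInner]

theorem frobeniusInner_mul_right (A : Matrix p r ℝ) (B : Matrix p q ℝ) (C : Matrix q r ℝ) :
    frobeniusInner A (B * C) = frobeniusInner (Bᵀ * A) C := by
  simp [frobeniusInner, Matrix.mul_assoc]

theorem frobeniusInner_mul_left (A : Matrix p r ℝ) (B : Matrix p q ℝ) (C : Matrix q r ℝ) :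
    frobeniusInner A (B * C) = frobeniusInner (A * Cᵀ) B := by
  rw [frobeniusInner, frobeniusInner, transpose_mul, transpose_transpose, ← Matrix.mul_assoc,
    trace_mul_comm, ← Matrix.mul_assoc]

theorem frobenius_norm_add_sq (A B : Matrix p q ℝ) :
    ‖A + B‖ ^ 2 = ‖A‖ ^ 2 + 2 * frobeniusInner A B + ‖B‖ ^ 2 := by
  simp only [← frobeniusInner_self]
  rw [frobeniusInner_add_right, frobeniusInner_comm (A + B), frobeniusInner_comm (A + B),
    frobeniusInner_add_right, frobeniusInner_add_right, frobeniusInner_comm B A]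
  ring

theorem abs_frobeniusInner_le (A B : Matrix p q ℝ) : |frobeniusInner A B| ≤ ‖A‖ * ‖B‖ := by
  refine abs_le_of_sq_le_sq ?_ (by positivity)
  rw [mul_pow, frobenius_norm_sq_eq_sum, frobenius_norm_sq_eq_sum, frobeniusInner_eq_sum,
    Finset.sum_comm]
  simp only [← Fintype.sum_prod_type']
  exact Finset.sum_mul_sq_le_sq_mul_sq _ _ _

theorem frobeniusInner_single [DecidableEq p] [DecidableEq q] (A : Matrix p q ℝ) (i : p) (j : q) :
    frobeniusInner A (single i j 1) = A i j := by
  rw [frobeniusInner, trace_mul_comm, trace_single_mul]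
  simp

end FrobeniusInner

end Matrix

/-! ### Gradients of functions of a matrix -/

namespace BilevelRep

open Matrix Filter Topology

section Gradient

variable {p q : Type*} [Fintype p] [Fintype q] [DecidableEq p] [DecidableEq q]

/-- Every loss here is exactly quadratic along lines in each block, so its gradient is read off as
the linear coefficient. -/
theorem matGrad_eq_of_quadratic {f : Matrix p q ℝ → ℝ} {W G : Matrix p q ℝ}
    (h : ∀ D, ∃ c : ℝ, ∀ t : ℝ, f (W + t • D) = f W + t * frobeniusInner G D + t ^ 2 * c) :
    matGrad f W = G := by
  ext i j
  obtain ⟨c, hc⟩ := h (single i j 1)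
  rw [frobeniusInner_single] at hc
  have h1 : HasDerivAt (fun t : ℝ => f (W + t • single i j 1)) (G i j) 0 := by
    simp only [hc]
    have h2 := (((hasDerivAt_id (0 : ℝ)).mul_const (G i j)).const_add (f W)).add
      (((hasDerivAt_id (0 : ℝ)).pow 2).mul_const c)
    convert! h2 using 1
    simp
  exact HasLineDerivAt.lineDeriv h1

theorem matGrad_congr {f g : Matrix p q ℝ → ℝ} {W : Matrix p q ℝ} (h : f =ᶠ[𝓝 W] g) :
    matGrad f W = matGrad g W := by
  ext i j
  exact h.lineDeriv_eq

theorem matGrad_const (c : ℝ) (W : Matrix p q ℝ) : matGrad (fun _ => c) W = 0 :=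
  matGrad_eq_of_quadratic fun D => ⟨0, fun t => by simp [frobeniusInner]⟩

end Gradient

/-! ### Least squares and its PL inequality -/

section LeastSquares

variable {p q r s : Type*} [Fintype p] [Fintype q] [Fintype r] [Fintype s]

/-- The least-squares loss of the linear model `W`. -/
def lsLoss (X : Matrix p q ℝ) (Y : Matrix p r ℝ) (W : Matrix q r ℝ) : ℝ :=
  1 / 2 * ‖Y - X * W‖ ^ 2

/-- The gradient of the least-squares loss. -/
def lsGrad (X : Matrix p q ℝ) (Y : Matrix p r ℝ) (W : Matrix q r ℝ) : Matrix q r ℝ :=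
  Xᵀ * (X * W - Y)

variable (X : Matrix p q ℝ) (Y : Matrix p r ℝ)

theorem lsLoss_nonneg (W : Matrix q r ℝ) : 0 ≤ lsLoss X Y W := by
  unfold lsLoss; positivity

theorem lsLoss_add (W E : Matrix q r ℝ) :
    lsLoss X Y (W + E) =
      lsLoss X Y W + frobeniusInner (lsGrad X Y W) E + 1 / 2 * ‖X * E‖ ^ 2 := by
  have h1 : Y - X * (W + E) = -((X * W - Y) + X * E) := by
    rw [Matrix.mul_add]; abel
  have h2 : Y - X * W = -(X * W - Y) := by abel
  rw [lsLoss, lsLoss, h1, h2, norm_neg, norm_neg, frobenius_norm_add_sq, lsGrad,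
    frobeniusInner_mul_right]
  ring

theorem matGrad_lsLoss_left [DecidableEq q] [DecidableEq s] (a : Matrix q s ℝ)
    (b : Matrix s r ℝ) :
    matGrad (fun V => lsLoss X Y (V * b)) a = lsGrad X Y (a * b) * bᵀ := by
  refine matGrad_eq_of_quadratic fun D => ⟨1 / 2 * ‖X * (D * b)‖ ^ 2, fun t => ?_⟩
  rw [Matrix.add_mul, lsLoss_add, Matrix.smul_mul, frobeniusInner_smul_right,
    frobeniusInner_mul_left, Matrix.mul_smul, norm_smul, mul_pow, Real.norm_eq_abs, sq_abs]
  ring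

theorem matGrad_lsLoss_right [DecidableEq s] [DecidableEq r] (a : Matrix q s ℝ)
    (b : Matrix s r ℝ) :
    matGrad (fun V => lsLoss X Y (a * V)) b = aᵀ * lsGrad X Y (a * b) := by
  refine matGrad_eq_of_quadratic fun D => ⟨1 / 2 * ‖X * (a * D)‖ ^ 2, fun t => ?_⟩
  rw [Matrix.mul_add, lsLoss_add, Matrix.mul_smul, frobeniusInner_smul_right,
    frobeniusInner_mul_right, Matrix.mul_smul, norm_smul, mul_pow, Real.norm_eq_abs, sq_abs]
  ring

/-- The normal equations are solvable in each column because `Xᵀ X` and `Xᵀ` have the same range. -/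
theorem exists_lsGrad_eq_zero {p q r : Type*} [Fintype p] [Fintype q] (X : Matrix p q ℝ)
    (Y : Matrix p r ℝ) : ∃ W : Matrix q r ℝ, lsGrad X Y W = 0 := by
  classical
  have h (j : r) : ∃ w : EuclideanSpace ℝ q, toEuclideanLin Xᵀ (toEuclideanLin X w) =
      toEuclideanLin Xᵀ (WithLp.toLp 2 (Y.col j)) := by
    have h1 := (toEuclideanLin X).range_adjoint_comp_self
    have h2 : LinearMap.adjoint (toEuclideanLin X) (WithLp.toLp 2 (Y.col j)) ∈
      (LinearMap.adjoint (toEuclideanLin X)).range := ⟨_, rfl⟩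
    rw [← h1, adjoint_toEuclideanLin] at h2
    exact h2
  choose w hw using h
  refine ⟨Matrix.of fun i j => w j i, ?_⟩
  rw [lsGrad, Matrix.mul_sub, sub_eq_zero]
  ext i j
  have h3 : WithLp.toLp 2 ((Xᵀ * (X * Matrix.of fun i j => w j i)).col j) =
      WithLp.toLp 2 ((Xᵀ * Y).col j) := by
    rw [toLp_col_mul, toLp_col_mul, toLp_col_mul]
    exact hw j
  exact congrArg (fun v : EuclideanSpace ℝ q => v i) h3

variable {X Y}

theorem lsLoss_eq_of_lsGrad_eq_zero {W₀ : Matrix q r ℝ} (h : lsGrad X Y W₀ = 0)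
    (W : Matrix q r ℝ) :
    lsLoss X Y W = lsLoss X Y W₀ + 1 / 2 * ‖X * (W - W₀)‖ ^ 2 := by
  have := lsLoss_add X Y W₀ (W - W₀)
  rw [add_sub_cancel, h] at this
  rw [this]
  simp [frobeniusInner]

theorem lsLoss_le_of_lsGrad_eq_zero {W₀ : Matrix q r ℝ} (h : lsGrad X Y W₀ = 0)
    (W : Matrix q r ℝ) : lsLoss X Y W₀ ≤ lsLoss X Y W := by
  rw [lsLoss_eq_of_lsGrad_eq_zero h W]
  have : 0 ≤ ‖X * (W - W₀)‖ ^ 2 := by positivity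
  linarith

theorem lsGrad_eq_of_lsGrad_eq_zero {p q r : Type*} [Fintype p] [Fintype q]
    {X : Matrix p q ℝ} {Y : Matrix p r ℝ} {W₀ : Matrix q r ℝ} (h : lsGrad X Y W₀ = 0)
    (W : Matrix q r ℝ) : lsGrad X Y W = Xᵀ * (X * (W - W₀)) := by
  rw [← sub_zero (lsGrad X Y W), ← h, lsGrad, lsGrad]
  simp only [Matrix.mul_sub]
  abel

theorem norm_lsGrad_le [DecidableEq p] [DecidableEq q] {W₀ : Matrix q r ℝ}
    (h : lsGrad X Y W₀ = 0) (W : Matrix q r ℝ) :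
    ‖lsGrad X Y W‖ ≤ √(2 * sigmaMax X ^ 2 * (lsLoss X Y W - lsLoss X Y W₀)) := by
  refine Real.le_sqrt_of_sq_le ?_
  rw [lsGrad_eq_of_lsGrad_eq_zero h, lsLoss_eq_of_lsGrad_eq_zero h]
  calc ‖Xᵀ * (X * (W - W₀))‖ ^ 2 ≤ (sigmaMax X * ‖X * (W - W₀)‖) ^ 2 := by
        gcongr
        exact norm_transpose_mul_le_sigmaMax _ _
    _ = _ := by ring

/-- The loss gap is `½ ‖X (W - W₀)‖ ^ 2` and the gradient is `Xᵀ` applied to `X (W - W₀)`, which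
lies in the range of `X`; there `Xᵀ` shrinks norms by at most the factor `sigmaStar X`. -/
theorem le_norm_sq_lsGrad [DecidableEq p] [DecidableEq q] {W₀ : Matrix q r ℝ}
    (h : lsGrad X Y W₀ = 0) (W : Matrix q r ℝ) :
    2 * sigmaStar X ^ 2 * (lsLoss X Y W - lsLoss X Y W₀) ≤ ‖lsGrad X Y W‖ ^ 2 := by
  rw [lsGrad_eq_of_lsGrad_eq_zero h, lsLoss_eq_of_lsGrad_eq_zero h]
  calc 2 * sigmaStar X ^ 2 *
        (lsLoss X Y W₀ + 1 / 2 * ‖X * (W - W₀)‖ ^ 2 - lsLoss X Y W₀)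
      = (sigmaStar X * ‖X * (W - W₀)‖) ^ 2 := by ring
    _ ≤ _ := by
        have := sigmaStar_nonneg X
        gcongr
        exact sigmaStar_mul_norm_le _ _

theorem joint_pl_lsLoss [DecidableEq p] [DecidableEq q] [DecidableEq r] [DecidableEq s]
    {W₀ : Matrix q r ℝ}
    (h : lsGrad X Y W₀ = 0) (a : Matrix q s ℝ) (b : Matrix s r ℝ)
    (hqs : Fintype.card q ≤ Fintype.card s) (hrs : Fintype.card r ≤ Fintype.card s) :
    2 * ((sigmaMin a ^ 2 + sigmaMin b ^ 2) * sigmaStar X ^ 2) *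
        (lsLoss X Y (a * b) - lsLoss X Y W₀) ≤
      ‖lsGrad X Y (a * b) * bᵀ‖ ^ 2 + ‖aᵀ * lsGrad X Y (a * b)‖ ^ 2 := by
  set G := lsGrad X Y (a * b)
  have hG := le_norm_sq_lsGrad h (a * b)
  have h1 : sigmaMin b * ‖G‖ ≤ ‖G * bᵀ‖ := by
    rw [← frobenius_norm_transpose (G * bᵀ), ← frobenius_norm_transpose G, transpose_mul,
      transpose_transpose]
    exact sigmaMin_mul_norm_le_norm_mul b hrs _
  have h2 : sigmaMin a * ‖G‖ ≤ ‖aᵀ * G‖ := sigmaMin_mul_norm_le_norm_transpose_mul a hqs _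
  have h3 := pow_le_pow_left₀ (mul_nonneg (sigmaMin_nonneg b) (norm_nonneg G)) h1 2
  have h4 := pow_le_pow_left₀ (mul_nonneg (sigmaMin_nonneg a) (norm_nonneg G)) h2 2
  have h5 := mul_le_mul_of_nonneg_left hG
    (show 0 ≤ sigmaMin a ^ 2 + sigmaMin b ^ 2 by positivity)
  linarith

end LeastSquares

end BilevelRep

/-! ### Descent for the factored least-squares loss -/

namespace BilevelRep

open Matrix

/-- The scalars stand for norms in `descent_lsLoss`: `A`, `B` of the block gradients, `d` of the
bias, `u`, `e` of `U`, `E`, `f` of the product of the gradients; `x`, `y` are `sigmaMax` of `b`,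
`a`, and `r` bounds the full gradient. Of the six products in `u * e`, each keeps a factor `A * B`
or `d * B`, at most `S`, and the rest goes into the constant. -/
theorem cross_term_le {α A B d x y r e f u : ℝ} (hα : 0 ≤ α) (hA : 0 ≤ A) (hB : 0 ≤ B)
    (hd : 0 ≤ d) (hx : 0 ≤ x) (hy : 0 ≤ y) (hr : 0 ≤ r) (he0 : 0 ≤ e)
    (hBy : B ≤ y * r) (hu : u ≤ x * A + x * d + y * B)
    (hfx : f ≤ x * r * B) (hfy : f ≤ y * r * A) (hfAB : f ≤ A * B)
    (he : e ≤ f + d * B) :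
    α * (u * e) ≤
      (3 * α * d * x + 3 * α * (y ^ 2 + x ^ 2) * r) * (A ^ 2 + B ^ 2 + d ^ 2) := by
  have hAB : 2 * (A * B) ≤ A ^ 2 + B ^ 2 := by nlinarith [sq_nonneg (A - B)]
  have hdB : 2 * (d * B) ≤ d ^ 2 + B ^ 2 := by nlinarith [sq_nonneg (d - B)]
  set S := A ^ 2 + B ^ 2 + d ^ 2 with hS
  have hABS : A * B ≤ S := by nlinarith
  have hdBS : d * B ≤ S := by nlinarith
  have h1 : x * A * f ≤ x ^ 2 * r * S := by
    calc x * A * f ≤ x * A * (x * r * B) := by gcongr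
      _ = x ^ 2 * r * (A * B) := by ring
      _ ≤ _ := by gcongr
  have h2 : y * B * f ≤ y ^ 2 * r * S := by
    calc y * B * f ≤ y * B * (y * r * A) := by gcongr
      _ = y ^ 2 * r * (A * B) := by ring
      _ ≤ _ := by gcongr
  have h3 : x * d * f ≤ d * x * S := by
    calc x * d * f ≤ x * d * (A * B) := by gcongr
      _ = d * x * (A * B) := by ring
      _ ≤ _ := by gcongr
  have h4 : x * A * (d * B) ≤ d * x * S := by
    calc x * A * (d * B) = d * x * (A * B) := by ring
      _ ≤ _ := by gcongr
  have h5 : x * d * (d * B) ≤ d * x * S := by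
    calc x * d * (d * B) = d * x * (d * B) := by ring
      _ ≤ _ := by gcongr
  have h6 : y * B * (d * B) ≤ y ^ 2 * r * S := by
    calc y * B * (d * B) ≤ y * (y * r) * (d * B) := by gcongr
      _ = y ^ 2 * r * (d * B) := by ring
      _ ≤ _ := by gcongr
  have hS0 : 0 ≤ S := by positivity
  have h7 : u * e ≤ (x * A + x * d + y * B) * (f + d * B) := by
    calc u * e ≤ (x * A + x * d + y * B) * e := by gcongr
      _ ≤ _ := by gcongr
  have h8 : 0 ≤ x ^ 2 * r * S := by positivity
  have h9 : 0 ≤ y ^ 2 * r * S := by positivity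
  have h10 : u * e ≤ (3 * d * x + 3 * (y ^ 2 + x ^ 2) * r) * S := by linarith
  calc α * (u * e) ≤ α * ((3 * d * x + 3 * (y ^ 2 + x ^ 2) * r) * S) := by gcongr
    _ = _ := by ring

theorem quadratic_term_le {α A B d y r z e f : ℝ}
    (hB : 0 ≤ B) (hd : 0 ≤ d) (hy : 0 ≤ y) (hr : 0 ≤ r) (hz : 0 ≤ z) (he0 : 0 ≤ e)
    (hf0 : 0 ≤ f) (hBy : B ≤ y * r) (hfz : f ≤ z * r ^ 2) (hfAB : f ≤ A * B)
    (he : e ≤ f + d * B) :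
    α ^ 2 * (1 / 2 * e ^ 2) ≤
      (3 * α ^ 2 * d * y * r + 3 * α ^ 2 * z * r ^ 2) * (A ^ 2 + B ^ 2 + d ^ 2) := by
  have hAB : 2 * (A * B) ≤ A ^ 2 + B ^ 2 := by nlinarith [sq_nonneg (A - B)]
  have hdB : 2 * (d * B) ≤ d ^ 2 + B ^ 2 := by nlinarith [sq_nonneg (d - B)]
  set S := A ^ 2 + B ^ 2 + d ^ 2 with hS
  have hABS : A * B ≤ S := by nlinarith
  have hdBS : d * B ≤ S := by nlinarith
  have hS0 : 0 ≤ S := by positivity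
  have h1 : f ^ 2 ≤ z * r ^ 2 * S := by
    calc f ^ 2 = f * f := by ring
      _ ≤ z * r ^ 2 * (A * B) := by gcongr
      _ ≤ _ := by gcongr
  have h2 : (d * B) ^ 2 ≤ d * y * r * S := by
    calc (d * B) ^ 2 = d * B * (d * B) := by ring
      _ ≤ d * (y * r) * S := by gcongr
      _ = _ := by ring
  have h3 : e ^ 2 ≤ 2 * (f ^ 2 + (d * B) ^ 2) := by
    calc e ^ 2 ≤ (f + d * B) ^ 2 := by gcongr
      _ ≤ _ := by nlinarith [sq_nonneg (f - d * B)]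
  have h4 : 0 ≤ z * r ^ 2 * S := by positivity
  have h5 : 0 ≤ d * y * r * S := by positivity
  calc α ^ 2 * (1 / 2 * e ^ 2)
      ≤ α ^ 2 * ((3 * d * y * r + 3 * z * r ^ 2) * S) :=
        mul_le_mul_of_nonneg_left (by linarith) (sq_nonneg α)
    _ = _ := by ring

theorem step_norm_sq_le {α A B d x y r z e f u v : ℝ} (hα : 0 ≤ α) (hA : 0 ≤ A)
    (hB : 0 ≤ B) (hd : 0 ≤ d) (hx : 0 ≤ x) (hy : 0 ≤ y) (hr : 0 ≤ r) (hz : 0 ≤ z)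
    (hu0 : 0 ≤ u) (he0 : 0 ≤ e) (hf0 : 0 ≤ f) (hv0 : 0 ≤ v) (hBy : B ≤ y * r)
    (hfx : f ≤ x * r * B) (hfy : f ≤ y * r * A) (hfz : f ≤ z * r ^ 2) (hfAB : f ≤ A * B)
    (he : e ≤ f + d * B) (hu : u ≤ x * A + x * d + y * B) (hv : v ≤ α * u + α ^ 2 * e) :
    1 / 2 * v ^ 2 ≤ α ^ 2 * ((y ^ 2 + x ^ 2) + 3 * α * d * x + 3 * α * (y ^ 2 + x ^ 2) * r
        + 3 * α ^ 2 * d * y * r + 3 * α ^ 2 * z * r ^ 2) * (A ^ 2 + B ^ 2 + d ^ 2) := by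
  have h1 := cross_term_le hα hA hB hd hx hy hr he0 hBy hu hfx hfy hfAB he
  have h2 := quadratic_term_le (α := α) hB hd hy hr hz he0 hf0 hBy hfz hfAB he
  -- Cauchy–Schwarz on `x * (A + d) + y * B`; the factor `2` from `(A + d) ^ 2` is absorbed by the
  -- `1 / 2`.
  have h3 : 1 / 2 * u ^ 2 ≤ (y ^ 2 + x ^ 2) * (A ^ 2 + B ^ 2 + d ^ 2) := by
    have h4 : u ^ 2 ≤ (x * (A + d) + y * B) ^ 2 := by
      gcongr
      linarith
    have h5 : (x * (A + d) + y * B) ^ 2 ≤ (y ^ 2 + x ^ 2) * ((A + d) ^ 2 + B ^ 2) := by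
      nlinarith [sq_nonneg (x * B - y * (A + d))]
    have h6 : (y ^ 2 + x ^ 2) * ((A + d) ^ 2 + B ^ 2) ≤
        (y ^ 2 + x ^ 2) * (2 * (A ^ 2 + B ^ 2 + d ^ 2)) := by
      gcongr
      nlinarith [sq_nonneg (A - d), sq_nonneg B]
    linarith
  have h7 : v ^ 2 ≤ (α * u + α ^ 2 * e) ^ 2 := by gcongr
  have h8 : 1 / 2 * (α * u + α ^ 2 * e) ^ 2 =
      α ^ 2 * (1 / 2 * u ^ 2 + α * (u * e) + α ^ 2 * (1 / 2 * e ^ 2)) := by ring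
  have h9 : α ^ 2 * (1 / 2 * u ^ 2 + α * (u * e) + α ^ 2 * (1 / 2 * e ^ 2)) ≤
      α ^ 2 * ((y ^ 2 + x ^ 2) * (A ^ 2 + B ^ 2 + d ^ 2) +
        (3 * α * d * x + 3 * α * (y ^ 2 + x ^ 2) * r) * (A ^ 2 + B ^ 2 + d ^ 2) +
        (3 * α ^ 2 * d * y * r + 3 * α ^ 2 * z * r ^ 2) * (A ^ 2 + B ^ 2 + d ^ 2)) := by
    gcongr
  linarith

theorem inner_term_le {r g A B d t : ℝ} (hg : g ≤ r) (hg0 : 0 ≤ g) (hB : 0 ≤ B)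
    (ht0 : 0 ≤ t) (ht : t ≤ A + d) : g * (t * B) ≤ r * (A ^ 2 + B ^ 2 + d ^ 2) := by
  have h1 : t ^ 2 ≤ (A + d) ^ 2 := by gcongr
  have h2 : t * B ≤ A ^ 2 + B ^ 2 + d ^ 2 := by
    nlinarith [sq_nonneg (t - B), sq_nonneg (A - d), sq_nonneg B]
  have h3 := mul_nonneg ht0 hB
  calc g * (t * B) ≤ r * (t * B) := by gcongr
    _ ≤ _ := by
      have := hg0.trans hg
      gcongr

variable {p q r s : Type*} [Fintype p] [Fintype q] [Fintype r] [Fintype s] [DecidableEq p]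
  [DecidableEq q] [DecidableEq r] [DecidableEq s] {X : Matrix p q ℝ} {Y : Matrix p r ℝ}

theorem descent_lsLoss {W₀ : Matrix q r ℝ} (h : lsGrad X Y W₀ = 0) (a δ : Matrix q s ℝ)
    (b : Matrix s r ℝ) {α : ℝ} (hα : 0 < α) {A : Matrix q s ℝ} {B : Matrix s r ℝ}
    (hA : A = lsGrad X Y (a * b) * bᵀ) (hB : B = aᵀ * lsGrad X Y (a * b)) {ρ L : ℝ}
    (hρ : ρ = √(2 * sigmaMax X ^ 2 * (lsLoss X Y (a * b) - lsLoss X Y W₀)))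
    (hL : L = sigmaMax X ^ 2 * ((sigmaMax a ^ 2 + sigmaMax b ^ 2) + 3 * α * ‖δ‖ * sigmaMax b
        + 3 * α * (sigmaMax a ^ 2 + sigmaMax b ^ 2) * ρ + 3 * α ^ 2 * ‖δ‖ * sigmaMax a * ρ
        + 3 * α ^ 2 * sigmaMax (a * b) * ρ ^ 2) + ρ) :
    lsLoss X Y ((a - α • (A + δ)) * (b - α • B)) ≤
      lsLoss X Y (a * b) - (α / 2 - α ^ 2 * L) * (‖A‖ ^ 2 + ‖B‖ ^ 2)
        + (α / 2 + α ^ 2 * L) * ‖δ‖ ^ 2 := by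
  set G := lsGrad X Y (a * b) with hG
  have hGρ : ‖G‖ ≤ ρ := hρ ▸ norm_lsGrad_le h (a * b)
  have hρ0 : 0 ≤ ρ := hρ ▸ Real.sqrt_nonneg _
  have hx : 0 ≤ sigmaMax b := sv_nonneg b 0
  have hy : 0 ≤ sigmaMax a := sv_nonneg a 0
  have hz : 0 ≤ sigmaMax (a * b) := sv_nonneg _ 0
  have hs : 0 ≤ sigmaMax X := sv_nonneg X 0
  set U := (A + δ) * b + a * B with hU
  set E := (A + δ) * B with hE
  have hstep : (a - α • (A + δ)) * (b - α • B) = a * b + (-(α • U) + α ^ 2 • E) := by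
    rw [hU, hE]
    generalize A + δ = C
    simp only [Matrix.sub_mul, Matrix.mul_sub, Matrix.smul_mul, Matrix.mul_smul, smul_sub,
      smul_smul]
    rw [smul_add, sq]
    abel
  rw [hstep, lsLoss_add, ← hG]
  have hGU : frobeniusInner G U = ‖A‖ ^ 2 + frobeniusInner A δ + ‖B‖ ^ 2 := by
    rw [hU, frobeniusInner_add_right, frobeniusInner_mul_left, frobeniusInner_mul_right, ← hA,
      ← hB, frobeniusInner_add_right, frobeniusInner_self, frobeniusInner_self]
  have hinner : frobeniusInner G (-(α • U) + α ^ 2 • E) =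
      -α * (‖A‖ ^ 2 + frobeniusInner A δ + ‖B‖ ^ 2) + α ^ 2 * frobeniusInner G E := by
    rw [frobeniusInner_add_right, ← neg_smul, frobeniusInner_smul_right,
      frobeniusInner_smul_right, hGU]
  -- Young's inequality: this costs half of the decrease in `A` and yields the coefficient `α / 2`
  -- of the bias.
  have hAδ : -frobeniusInner A δ ≤ 1 / 2 * ‖A‖ ^ 2 + 1 / 2 * ‖δ‖ ^ 2 := by
    have := neg_le_of_abs_le (abs_frobeniusInner_le A δ)
    nlinarith [sq_nonneg (‖A‖ - ‖δ‖)]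
  have hGE : frobeniusInner G E ≤ ρ * (‖A‖ ^ 2 + ‖B‖ ^ 2 + ‖δ‖ ^ 2) := by
    refine le_trans ((le_of_abs_le (abs_frobeniusInner_le G E)).trans ?_)
      (inner_term_le hGρ (norm_nonneg _) (norm_nonneg B) (norm_nonneg (A + δ))
        (norm_add_le A δ))
    gcongr
    exact frobenius_norm_mul _ _
  have hBn : ‖B‖ ≤ sigmaMax a * ρ := by
    rw [hB]
    exact (norm_transpose_mul_le_sigmaMax a G).trans (by gcongr)
  have hABeq : A * B = G * ((a * b)ᵀ * G) := by
    rw [hA, hB, transpose_mul]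
    simp only [Matrix.mul_assoc]
  have hfx : ‖A * B‖ ≤ sigmaMax b * ρ * ‖B‖ := by
    calc ‖A * B‖ = ‖G * (bᵀ * B)‖ := by rw [hA, Matrix.mul_assoc]
      _ ≤ ‖G‖ * ‖bᵀ * B‖ := frobenius_norm_mul _ _
      _ ≤ ρ * (sigmaMax b * ‖B‖) := by
          gcongr
          exact norm_transpose_mul_le_sigmaMax b B
      _ = _ := by ring
  have hfy : ‖A * B‖ ≤ sigmaMax a * ρ * ‖A‖ := by
    calc ‖A * B‖ = ‖A * aᵀ * G‖ := by rw [hB, Matrix.mul_assoc]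
      _ ≤ ‖A * aᵀ‖ * ‖G‖ := frobenius_norm_mul _ _
      _ ≤ (sigmaMax a * ‖A‖) * ρ := by
          gcongr
          exact norm_mul_transpose_le_sigmaMax a A
      _ = _ := by ring
  have hfz : ‖A * B‖ ≤ sigmaMax (a * b) * ρ ^ 2 := by
    calc ‖A * B‖ ≤ ‖G‖ * ‖(a * b)ᵀ * G‖ := hABeq ▸ frobenius_norm_mul _ _
      _ ≤ ρ * (sigmaMax (a * b) * ρ) := by
          gcongr
          exact (norm_transpose_mul_le_sigmaMax (a * b) G).trans (by gcongr)
      _ = _ := by ring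
  have hEn : ‖E‖ ≤ ‖A * B‖ + ‖δ‖ * ‖B‖ := by
    rw [hE, Matrix.add_mul]
    exact (norm_add_le _ _).trans (by gcongr; exact frobenius_norm_mul _ _)
  have hUn : ‖U‖ ≤ sigmaMax b * ‖A‖ + sigmaMax b * ‖δ‖ + sigmaMax a * ‖B‖ := by
    rw [hU, Matrix.add_mul]
    refine (norm_add₃_le ..).trans ?_
    gcongr
    exacts [norm_mul_le_mul_sigmaMax b A, norm_mul_le_mul_sigmaMax b δ, norm_mul_le_sigmaMax a B]
  have hVn : ‖-(α • U) + α ^ 2 • E‖ ≤ α * ‖U‖ + α ^ 2 * ‖E‖ := by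
    refine (norm_add_le _ _).trans (le_of_eq ?_)
    rw [norm_neg, norm_smul, norm_smul, Real.norm_of_nonneg hα.le,
      Real.norm_of_nonneg (sq_nonneg α)]
  have hquad := step_norm_sq_le hα.le (norm_nonneg A) (norm_nonneg B) (norm_nonneg δ) hx hy hρ0
    hz (norm_nonneg U) (norm_nonneg E) (norm_nonneg (A * B)) (norm_nonneg _) hBn hfx hfy hfz
    (frobenius_norm_mul A B) hEn hUn hVn
  have hXV : 1 / 2 * ‖X * (-(α • U) + α ^ 2 • E)‖ ^ 2 ≤
      sigmaMax X ^ 2 * (1 / 2 * ‖-(α • U) + α ^ 2 • E‖ ^ 2) := by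
    have := pow_le_pow_left₀ (norm_nonneg _)
      (norm_mul_le_sigmaMax X (-(α • U) + α ^ 2 • E)) 2
    linarith
  have h1 := hXV.trans (mul_le_mul_of_nonneg_left hquad (sq_nonneg (sigmaMax X)))
  have h2 := mul_le_mul_of_nonneg_left hGE (sq_nonneg α)
  have h3 := mul_le_mul_of_nonneg_left hAδ hα.le
  -- The block `B` has no bias and decreases with the full factor `α`; the surplus half is
  -- discarded.
  have h4 : 0 ≤ α * ‖B‖ ^ 2 := by positivity
  rw [hinner, hL]
  linarith

end BilevelRep

/-! ### Differentiability and right inverses -/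

namespace BilevelRep

open Matrix Filter Topology

theorem differentiable_entry {p q : Type*} [Fintype p] [Fintype q] (i : p) (j : q) :
    Differentiable ℝ fun W : Matrix p q ℝ => W i j :=
  (LinearMap.toContinuousLinearMap (Matrix.entryLinearMap ℝ ℝ i j)).differentiable

theorem differentiable_lsLoss_mul {p q r s : Type*} [Fintype p] [Fintype q] [Fintype r]
    [Fintype s] (X : Matrix p q ℝ) (Y : Matrix p r ℝ) :
    Differentiable ℝ fun W : Matrix q s ℝ × Matrix s r ℝ => lsLoss X Y (W.1 * W.2) := by
  have h₁ (i : q) (j : s) : Differentiable ℝ fun W : Matrix q s ℝ × Matrix s r ℝ => W.1 i j :=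
    (differentiable_entry i j).comp differentiable_fst
  have h₂ (i : s) (j : r) : Differentiable ℝ fun W : Matrix q s ℝ × Matrix s r ℝ => W.2 i j :=
    (differentiable_entry i j).comp differentiable_snd
  simp only [lsLoss, frobenius_norm_sq_eq_sum, Matrix.sub_apply, Matrix.mul_apply]
  fun_prop

theorem exists_mul_eq_one_of_rank_eq {p q : Type*} [Fintype p] [Fintype q] [DecidableEq p]
    (A : Matrix p q ℝ) (h : A.rank = Fintype.card p) : ∃ B : Matrix q p ℝ, A * B = 1 := by
  have h1 : LinearMap.range A.mulVecLin = ⊤ :=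
    Submodule.eq_top_of_finrank_eq (by rw [← Matrix.rank, h, Module.finrank_fintype_fun_eq_card])
  exact Matrix.mulVec_surjective_iff_exists_right_inverse.1 (LinearMap.range_eq_top.1 h1)

theorem exists_mul_eq_one_of_sigmaMin_pos {p q : Type*} [Fintype p] [Fintype q] [DecidableEq p]
    [DecidableEq q] (A : Matrix p q ℝ) (hpq : Fintype.card p ≤ Fintype.card q)
    (h : 0 < sigmaMin A) : ∃ B : Matrix q p ℝ, A * B = 1 := by
  have h1 : Function.Injective (Aᵀ).mulVecLin := by
    rw [injective_iff_map_eq_zero]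
    intro v hv
    -- The vector is viewed as a one-column matrix, so that the Frobenius bound applies.
    have h2 := sigmaMin_mul_norm_le_norm_transpose_mul A hpq (replicateCol Unit v)
    rw [← replicateCol_mulVec] at h2
    rw [mulVecLin_apply] at hv
    rw [hv, replicateCol_zero, norm_zero] at h2
    have h3 : replicateCol Unit v = 0 :=
      norm_le_zero_iff.1 (nonpos_of_mul_nonpos_right h2 h)
    ext i
    exact congrFun (congrFun h3 i) ()
  refine exists_mul_eq_one_of_rank_eq A ?_
  rw [← rank_transpose, Matrix.rank, LinearMap.finrank_range_of_inj h1]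
  simp

/-- With `B` fixed, `det (V * B)` is continuous in `V` and equals `1` at `A`; where it is nonzero,
`B * (V * B)⁻¹` is a right inverse. -/
theorem eventually_exists_mul_eq_one {p q : Type*} [Fintype p] [Fintype q] [DecidableEq p]
    {A : Matrix p q ℝ} (h : ∃ B : Matrix q p ℝ, A * B = 1) :
    ∀ᶠ V : Matrix p q ℝ in 𝓝 A, ∃ B : Matrix q p ℝ, V * B = 1 := by
  obtain ⟨B, hB⟩ := h
  have hc : Continuous fun V : Matrix p q ℝ => (V * B).det :=
    (continuous_id.matrix_mul continuous_const).matrix_det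
  have h1 : (A * B).det ≠ 0 := by simp [hB]
  filter_upwards [hc.continuousAt.eventually_ne h1] with V hV
  exact ⟨B * (V * B)⁻¹, by rw [← Matrix.mul_assoc, Matrix.mul_nonsing_inv _ hV.isUnit]⟩

/-! ### The penalized objective as stacked least squares -/

namespace Data

variable {N N' m n h : ℕ} (D : Data N N' m n)

/-- The stacked labels `[Y_val; √γ Y_trn]`. -/
def Ypen (γ : ℝ) : Matrix (Fin N' ⊕ Fin N) (Fin n) ℝ :=
  Matrix.fromRows D.Yval (√γ • D.Ytrn)

theorem Ltrn_eq_lsLoss (a : Matrix (Fin m) (Fin h) ℝ) (b : Matrix (Fin h) (Fin n) ℝ) :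
    D.Ltrn a b = lsLoss D.Xtrn D.Ytrn (a * b) := by
  rw [Ltrn, lsLoss, Matrix.mul_assoc]

theorem Lval_eq_lsLoss (a : Matrix (Fin m) (Fin h) ℝ) (b : Matrix (Fin h) (Fin n) ℝ) :
    D.Lval a b = lsLoss D.Xval D.Yval (a * b) := by
  rw [Lval, lsLoss, Matrix.mul_assoc]

theorem lsLoss_pen {γ : ℝ} (hγ : 0 ≤ γ) (W : Matrix (Fin m) (Fin n) ℝ) :
    lsLoss (D.Xpen γ) (D.Ypen γ) W =
      lsLoss D.Xval D.Yval W + γ * lsLoss D.Xtrn D.Ytrn W := by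
  have h1 : D.Ypen γ - D.Xpen γ * W =
      Matrix.fromRows (D.Yval - D.Xval * W) (√γ • (D.Ytrn - D.Xtrn * W)) := by
    rw [Ypen, Xpen, Matrix.fromRows_mul, Matrix.smul_mul, smul_sub]
    ext (i | i) j <;> simp
  have h2 : ‖D.Ypen γ - D.Xpen γ * W‖ ^ 2 =
      ‖D.Yval - D.Xval * W‖ ^ 2 + ‖√γ • (D.Ytrn - D.Xtrn * W)‖ ^ 2 := by
    rw [h1, frobenius_norm_sq_eq_sum, Fintype.sum_sum_type]
    simp only [Matrix.fromRows_apply_inl, Matrix.fromRows_apply_inr, ← frobenius_norm_sq_eq_sum]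
  rw [lsLoss, h2, norm_smul, mul_pow, Real.norm_eq_abs, sq_abs, Real.sq_sqrt hγ, lsLoss, lsLoss]
  ring

theorem lsGrad_pen {γ : ℝ} (hγ : 0 ≤ γ) (W : Matrix (Fin m) (Fin n) ℝ) :
    lsGrad (D.Xpen γ) (D.Ypen γ) W =
      lsGrad D.Xval D.Yval W + γ • lsGrad D.Xtrn D.Ytrn W := by
  have h1 : D.Xpen γ * W - D.Ypen γ =
      Matrix.fromRows (D.Xval * W - D.Yval) (√γ • (D.Xtrn * W - D.Ytrn)) := by
    rw [Ypen, Xpen, Matrix.fromRows_mul, Matrix.smul_mul, smul_sub]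
    ext (i | i) j <;> simp
  rw [lsGrad, h1, Xpen, Matrix.transpose_fromRows, Matrix.fromCols_mul_fromRows,
    Matrix.transpose_smul, Matrix.smul_mul, Matrix.mul_smul, smul_smul, Real.mul_self_sqrt hγ]
  rfl

theorem Ltrn_nonneg (a : Matrix (Fin m) (Fin h) ℝ) (b : Matrix (Fin h) (Fin n) ℝ) :
    0 ≤ D.Ltrn a b := by
  rw [Ltrn_eq_lsLoss]; exact lsLoss_nonneg _ _ _

theorem LtrnStar_nonneg (a : Matrix (Fin m) (Fin h) ℝ) : 0 ≤ D.LtrnStar a :=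
  Real.iInf_nonneg fun b => D.Ltrn_nonneg a b

theorem LtrnStar_le (a : Matrix (Fin m) (Fin h) ℝ) (b : Matrix (Fin h) (Fin n) ℝ) :
    D.LtrnStar a ≤ D.Ltrn a b :=
  ciInf_le ⟨0, Set.forall_mem_range.2 fun b => D.Ltrn_nonneg a b⟩ b

theorem exists_Ltrn_eq_zero (hX : D.Xtrn.rank = N) {a : Matrix (Fin m) (Fin h) ℝ}
    (ha : ∃ c : Matrix (Fin h) (Fin m) ℝ, a * c = 1) :
    ∃ b : Matrix (Fin h) (Fin n) ℝ, D.Ltrn a b = 0 := by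
  obtain ⟨c, hc⟩ := ha
  obtain ⟨Z, hZ⟩ := exists_mul_eq_one_of_rank_eq D.Xtrn (by simpa using hX)
  refine ⟨c * (Z * D.Ytrn), ?_⟩
  rw [Ltrn_eq_lsLoss, ← Matrix.mul_assoc a, hc, Matrix.one_mul, lsLoss, ← Matrix.mul_assoc, hZ,
    Matrix.one_mul]
  simp

theorem LtrnStar_eq_zero (hX : D.Xtrn.rank = N) {a : Matrix (Fin m) (Fin h) ℝ}
    (ha : ∃ c : Matrix (Fin h) (Fin m) ℝ, a * c = 1) : D.LtrnStar a = 0 := by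
  obtain ⟨b, hb⟩ := D.exists_Ltrn_eq_zero hX ha
  exact le_antisymm (hb ▸ D.LtrnStar_le a b) (D.LtrnStar_nonneg a)

theorem Lpen_eq_lsLoss_sub {γ : ℝ} (hγ : 0 ≤ γ) (a : Matrix (Fin m) (Fin h) ℝ)
    (b : Matrix (Fin h) (Fin n) ℝ) :
    D.Lpen γ a b = lsLoss (D.Xpen γ) (D.Ypen γ) (a * b) - γ * D.LtrnStar a := by
  rw [Lpen, Lval_eq_lsLoss, Ltrn_eq_lsLoss, lsLoss_pen D hγ]
  ring

theorem Lpen_le_lsLoss {γ : ℝ} (hγ : 0 ≤ γ) (a : Matrix (Fin m) (Fin h) ℝ)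
    (b : Matrix (Fin h) (Fin n) ℝ) :
    D.Lpen γ a b ≤ lsLoss (D.Xpen γ) (D.Ypen γ) (a * b) := by
  rw [Lpen_eq_lsLoss_sub D hγ]
  have := mul_nonneg hγ (D.LtrnStar_nonneg a)
  linarith

theorem Lpen_eq_lsLoss (hX : D.Xtrn.rank = N) {γ : ℝ} (hγ : 0 ≤ γ)
    {a : Matrix (Fin m) (Fin h) ℝ} (ha : ∃ c : Matrix (Fin h) (Fin m) ℝ, a * c = 1)
    (b : Matrix (Fin h) (Fin n) ℝ) :
    D.Lpen γ a b = lsLoss (D.Xpen γ) (D.Ypen γ) (a * b) := by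
  rw [Lpen_eq_lsLoss_sub D hγ, D.LtrnStar_eq_zero hX ha, mul_zero, sub_zero]

/-- Under compatibility, the penalized objective is bounded below by the minimum of the joint
least-squares loss, even at weights for which the lower-level value is positive. -/
theorem lsLoss_le_Lpen (hX : D.Xtrn.rank = N) (hcomp : D.Compatible h) {γ : ℝ} (hγ : 0 ≤ γ)
    {a : Matrix (Fin m) (Fin h) ℝ} (ha : ∃ c : Matrix (Fin h) (Fin m) ℝ, a * c = 1)
    {W₀ : Matrix (Fin m) (Fin n) ℝ} (hW₀ : lsGrad (D.Xpen γ) (D.Ypen γ) W₀ = 0)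
    (V₁ : Matrix (Fin m) (Fin h) ℝ) (V₂ : Matrix (Fin h) (Fin n) ℝ) :
    lsLoss (D.Xpen γ) (D.Ypen γ) W₀ ≤ D.Lpen γ V₁ V₂ := by
  -- With `ε₂` the lower-level gap of `(V₁, V₂)`, that pair is itself feasible, so `U` has no larger
  -- validation loss. The joint training minimum is at most `0`, so the training loss of `U` is at
  -- most this gap.
  obtain ⟨U₁, U₂, ⟨-, hval⟩, htrn⟩ := hcomp 0 (D.Ltrn V₁ V₂ - D.LtrnStar V₁) le_rfl
    (sub_nonneg.2 (D.LtrnStar_le V₁ V₂))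
  have h1 := hval V₁ V₂ le_rfl
  obtain ⟨b, hb⟩ := D.exists_Ltrn_eq_zero hX ha
  have h2 : (⨅ V : Matrix (Fin m) (Fin h) ℝ × Matrix (Fin h) (Fin n) ℝ, D.Ltrn V.1 V.2) ≤ 0 :=
    hb ▸ ciInf_le (f := fun V : Matrix (Fin m) (Fin h) ℝ × Matrix (Fin h) (Fin n) ℝ =>
      D.Ltrn V.1 V.2) ⟨0, Set.forall_mem_range.2 fun V => D.Ltrn_nonneg V.1 V.2⟩ (a, b)
  have h3 : D.Ltrn U₁ U₂ ≤ D.Ltrn V₁ V₂ - D.LtrnStar V₁ := by linarith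
  calc lsLoss (D.Xpen γ) (D.Ypen γ) W₀ ≤ lsLoss (D.Xpen γ) (D.Ypen γ) (U₁ * U₂) :=
        lsLoss_le_of_lsGrad_eq_zero hW₀ _
    _ = D.Lval U₁ U₂ + γ * D.Ltrn U₁ U₂ := by
        rw [lsLoss_pen D hγ, Lval_eq_lsLoss, Ltrn_eq_lsLoss]
    _ ≤ (D.Lval V₁ V₂ + 0) + γ * (D.Ltrn V₁ V₂ - D.LtrnStar V₁) := by gcongr
    _ = D.Lpen γ V₁ V₂ := by rw [Lpen, add_zero]

theorem isLeast_range_Lpen (hX : D.Xtrn.rank = N) (hcomp : D.Compatible h) {γ : ℝ}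
    (hγ : 0 ≤ γ) {a : Matrix (Fin m) (Fin h) ℝ}
    (ha : ∃ c : Matrix (Fin h) (Fin m) ℝ, a * c = 1)
    {W₀ : Matrix (Fin m) (Fin n) ℝ} (hW₀ : lsGrad (D.Xpen γ) (D.Ypen γ) W₀ = 0) :
    IsLeast (Set.range fun W : Matrix (Fin m) (Fin h) ℝ × Matrix (Fin h) (Fin n) ℝ =>
      D.Lpen γ W.1 W.2) (lsLoss (D.Xpen γ) (D.Ypen γ) W₀) := by
  refine ⟨?_, Set.forall_mem_range.2 fun V => D.lsLoss_le_Lpen hX hcomp hγ ha hW₀ V.1 V.2⟩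
  obtain ⟨c, hc⟩ := ha
  refine ⟨(a, c * W₀), ?_⟩
  change D.Lpen γ a (c * W₀) = _
  rw [D.Lpen_eq_lsLoss hX hγ ⟨c, hc⟩, ← Matrix.mul_assoc, hc, Matrix.one_mul]

end Data

end BilevelRep

end

/-! ### The main theorem -/

open BilevelRep Matrix Filter Topology in
theorem lemma1 {N N' m n h : ℕ} (D : BilevelRep.Data N N' m n)
    (hNm : N ≤ m) (hN'm : N' ≤ m) (hmh : m ≤ h) (hnh : n ≤ h)
    (hXtrn : D.Xtrn.rank = N) (hXval : D.Xval.rank = N')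
    (hcomp : D.Compatible h)
    (γ : ℝ) (hγ : 0 < γ) (α β : ℝ) (hα : 0 < α) (T : ℕ → ℕ)
    (W₁ : ℕ → Matrix (Fin m) (Fin h) ℝ) (W₂ W₃ : ℕ → Matrix (Fin h) (Fin n) ℝ)
    (hPBGD : D.IsPBGD γ α β T W₁ W₂ W₃)
    (k : ℕ)
    (hW₁ : 0 < BilevelRep.sigmaMin (W₁ k) ^ 2) (hW₂ : 0 < BilevelRep.sigmaMin (W₂ k) ^ 2) :
    -- the minimum of the penalized objective exists
    IsLeast (Set.range fun W : Matrix (Fin m) (Fin h) ℝ × Matrix (Fin h) (Fin n) ℝ =>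
      D.Lpen γ W.1 W.2) (D.LpenStar h γ) ∧
    -- the gradients below are those of differentiable functions
    DifferentiableAt ℝ (fun W : Matrix (Fin m) (Fin h) ℝ × Matrix (Fin h) (Fin n) ℝ =>
      D.Lpen γ W.1 W.2) (W₁ k, W₂ k) ∧
    DifferentiableAt ℝ (fun V : Matrix (Fin m) (Fin h) ℝ => D.LtrnStar V) (W₁ k) ∧
    -- joint PL inequality
    D.normSqGradLpen γ (W₁ k) (W₂ k) ≥
      2 * D.plConst γ (W₁ k) (W₂ k) * (D.Lpen γ (W₁ k) (W₂ k) - D.LpenStar h γ) ∧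
    -- descent inequality
    D.Lpen γ (W₁ (k + 1)) (W₂ (k + 1)) ≤
      D.Lpen γ (W₁ k) (W₂ k)
        - (α / 2 - α ^ 2 * D.smoothConst γ α ‖D.gradBias γ (W₁ k) (W₃ (k + 1))‖ (W₁ k) (W₂ k))
          * D.normSqGradLpen γ (W₁ k) (W₂ k)
        + (α / 2 + α ^ 2 * D.smoothConst γ α ‖D.gradBias γ (W₁ k) (W₃ (k + 1))‖ (W₁ k) (W₂ k))
          * ‖D.gradBias γ (W₁ k) (W₃ (k + 1))‖ ^ 2 := by
  obtain ⟨-, hstep₁, hstep₂⟩ := hPBGD k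
  have hright : ∃ c : Matrix (Fin h) (Fin m) ℝ, W₁ k * c = 1 :=
    exists_mul_eq_one_of_sigmaMin_pos (W₁ k) (by simpa using hmh)
      ((sigmaMin_nonneg (W₁ k)).lt_of_ne fun h0 => by simp [← h0] at hW₁)
  obtain ⟨W₀, hW₀⟩ := exists_lsGrad_eq_zero (D.Xpen γ) (D.Ypen γ)
  have hleast := D.isLeast_range_Lpen hXtrn hcomp hγ.le hright hW₀
  have hstar : D.LpenStar h γ = lsLoss (D.Xpen γ) (D.Ypen γ) W₀ := hleast.csInf_eq
  have hnear := eventually_exists_mul_eq_one hright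
  have hStar_near : (fun V : Matrix (Fin m) (Fin h) ℝ => D.LtrnStar V) =ᶠ[𝓝 (W₁ k)]
      fun _ => 0 := hnear.mono fun V hV => D.LtrnStar_eq_zero hXtrn hV
  have hPen := D.Lpen_eq_lsLoss hXtrn hγ.le hright (W₂ k)
  have hgrad₁ : matGrad (fun V => D.Lpen γ V (W₂ k)) (W₁ k) =
      lsGrad (D.Xpen γ) (D.Ypen γ) (W₁ k * W₂ k) * (W₂ k)ᵀ := by
    rw [← matGrad_lsLoss_left]
    exact matGrad_congr (hnear.mono fun V hV => D.Lpen_eq_lsLoss hXtrn hγ.le hV (W₂ k))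
  have hgrad₂ : matGrad (fun V => D.Lpen γ (W₁ k) V) (W₂ k) =
      (W₁ k)ᵀ * lsGrad (D.Xpen γ) (D.Ypen γ) (W₁ k * W₂ k) := by
    rw [← matGrad_lsLoss_right]
    exact congrArg (matGrad · (W₂ k)) (funext fun V => D.Lpen_eq_lsLoss hXtrn hγ.le hright V)
  refine ⟨hstar ▸ hleast, ?_, ?_, ?_, ?_⟩
  · refine (differentiable_lsLoss_mul (D.Xpen γ) (D.Ypen γ)
      (W₁ k, W₂ k)).congr_of_eventuallyEq ?_
    filter_upwards [continuous_fst.continuousAt.eventually hnear] with V hV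
    exact D.Lpen_eq_lsLoss hXtrn hγ.le hV V.2
  · exact (differentiableAt_const 0).congr_of_eventuallyEq hStar_near
  · rw [ge_iff_le, Data.normSqGradLpen, hgrad₁, hgrad₂, Data.plConst, hPen, hstar]
    exact joint_pl_lsLoss hW₀ (W₁ k) (W₂ k) (by simpa using hmh) (by simpa using hnh)
  · set δ := D.gradBias γ (W₁ k) (W₃ (k + 1)) with hδ
    -- The value function is locally zero, so its gradient drops out of the bias, and the `W₁`
    -- update is a gradient step perturbed by `δ`.
    have hδ' : δ = -(γ • matGrad (fun V => D.Ltrn V (W₃ (k + 1))) (W₁ k)) := by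
      rw [hδ, Data.gradBias, matGrad_congr hStar_near, matGrad_const, zero_sub, smul_neg]
    have hnext₁ : W₁ (k + 1) = W₁ k -
        α • (lsGrad (D.Xpen γ) (D.Ypen γ) (W₁ k * W₂ k) * (W₂ k)ᵀ + δ) := by
      rw [hstep₁, hδ', smul_sub γ, D.lsGrad_pen hγ.le, Matrix.add_mul, Matrix.smul_mul,
        ← matGrad_lsLoss_left, ← matGrad_lsLoss_left]
      simp only [Data.Lval_eq_lsLoss, Data.Ltrn_eq_lsLoss, sub_eq_add_neg, add_assoc]
    have hnext₂ : W₂ (k + 1) = W₂ k -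
        α • ((W₁ k)ᵀ * lsGrad (D.Xpen γ) (D.Ypen γ) (W₁ k * W₂ k)) := by
      rw [hstep₂, D.lsGrad_pen hγ.le, Matrix.mul_add, Matrix.mul_smul,
        ← matGrad_lsLoss_right, ← matGrad_lsLoss_right]
      simp only [Data.Lval_eq_lsLoss, Data.Ltrn_eq_lsLoss]
    -- Only an inequality at the new point, where `W₁ (k + 1)` need not have full row rank.
    refine (D.Lpen_le_lsLoss hγ.le _ _).trans ?_
    rw [hnext₁, hnext₂, Data.normSqGradLpen, hgrad₁, hgrad₂, hPen]
    refine descent_lsLoss hW₀ (W₁ k) δ (W₂ k) hα rfl rfl rfl ?_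
    rw [Data.smoothConst, hPen, hstar]
    -- Squaring the root turns `3 α² s² ρ²` into the term `6 α² s⁴ Δ` of `smoothConst`, both
    -- multiplied by `sigmaMax (W₁ k * W₂ k)`.
    have hsq := Real.sq_sqrt (show 0 ≤ 2 * sigmaMax (D.Xpen γ) ^ 2 *
      (lsLoss (D.Xpen γ) (D.Ypen γ) (W₁ k * W₂ k) - lsLoss (D.Xpen γ) (D.Ypen γ) W₀) from
        mul_nonneg (by positivity) (sub_nonneg.2 (lsLoss_le_of_lsGrad_eq_zero hW₀ _)))
    rw [hsq]
    ring
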